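/- Let $G$ be a directed graph with finite vertex set $V$ and finite edge set $E$, in which each edge $e$ has a weight $W(e)>0$. Assume that for all vertices $u,v$ (possibly equal) there is at most one edge from $u$ to $v$. A path from $u$ to $v$ is a non-empty finite list of edges $x_1x_2\cdots x_k$ such that $x_1$ starts at $u$, $x_k$ ends at $v$, and $x_{i+1}$ starts at the vertex where $x_i$ ends for $1\le i<k$; vertices and edges may be repeated. Its weight is $W(x_1)+\cdots+W(x_k)$. The graph $G$ is strongly connected if for all $u,v\in V$ (including $u=v$) there is a path from $u$ to $v$, and it is a cycle if it is strongly connected and every vertex has in-degree and out-degree equal to $1$. For $i,j\in V$ let $a_{ij}=1$ if there is an edge from $j$ to $i$, and let $w_{ij}$ then be its weight; let $a_{ij}=0$ otherwise. Suppose that $G$ is strongly connected and is not a cycle. Then there is exactly one real number $s>0$ for which the matrix with entries $a_{ij}e^{-w_{ij}/s}$ (interpreted as $0$ when $a_{ij}=0$) has spectral radius $1$. Moreover, for all $v_1,v_2\in V$, not necessarily distinct, the weights of the paths from $v_1$ to $v_2$, each path being counted once, can be enumerated in ascending order as a sequence $p_1\le p_2\le p_3\le\cdots$, and $$\lim_{r\to\infty}\frac{p_r}{\log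 r}=s .$$ -/

import Mathlib

/-- An edge-weighted directed multigraph with vertex set `V` and edge set `E`: the edge `e` goes
from `I e` to `O e` and has the positive weight `W e`. -/
structure WeightedDigraph (V E : Type*) where
  I : E → V
  O : E → V
  W : E → ℝ
  W_pos : ∀ e, 0 < W e

namespace WeightedDigraph

variable {V E : Type*}

/-- There is at most one edge from `u` to `v`, for each ordered pair of (not necessarily distinct)
vertices. -/
def AtMostOneEdge (G : WeightedDigraph V E) : Prop :=
  ∀ e f : E, G.I e = G.I f → G.O e = G.O f → e = f

/-- The list of edges `x` is a path from `u` to `v`: it is non-empty, each edge starts where the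
preceding one ends, the first edge starts at `u`, and the last edge ends at `v`. -/
def IsPath (G : WeightedDigraph V E) (u v : V) (x : List E) : Prop :=
  List.IsChain (fun e f => G.I f = G.O e) x ∧
    ∃ h : x ≠ [], G.I (x.head h) = u ∧ G.O (x.getLast h) = v

/-- The set of all paths from `u` to `v`. -/
def paths (G : WeightedDigraph V E) (u v : V) : Set (List E) :=
  {x | G.IsPath u v x}

/-- The weight of a list of edges: the sum of the weights of its entries. -/
def pathWeight (G : WeightedDigraph V E) (x : List E) : ℝ :=
  (x.map G.W).sum

/-- Any two vertices `u`, `v` are joined by a path from `u` to `v` (for `u = v` as well). -/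
def StronglyConnected (G : WeightedDigraph V E) : Prop :=
  ∀ u v : V, ∃ x : List E, G.IsPath u v x

/-- A cycle: a strongly connected graph with all in-degrees and out-degrees equal to `1`. -/
def IsCycle (G : WeightedDigraph V E) : Prop :=
  G.StronglyConnected ∧
    ∀ v : V, Set.ncard {e : E | G.O e = v} = 1 ∧ Set.ncard {e : E | G.I e = v} = 1

/-- `p 1, p 2, p 3, …` enumerates in ascending order the weights of the paths in the set `X`,
each path being counted exactly once (so that a weight occurs with multiplicity). -/
def IsSequenceOfWeights (G : WeightedDigraph V E) (X : Set (List E)) (p : ℕ+ → ℝ) : Prop :=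
  Monotone p ∧ ∃ x : ℕ+ ≃ X, ∀ r : ℕ+, p r = G.pathWeight (x r : List E)

open Classical in
/-- The adjacency matrix: `a i j = 1` if there is an edge from `j` to `i`, and `0` otherwise. -/
noncomputable def adjMatrix (G : WeightedDigraph V E) : Matrix V V ℝ :=
  Matrix.of fun i j => if ∃ e : E, G.I e = j ∧ G.O e = i then 1 else 0

open Classical in
/-- `w i j` is the weight of the edge from `j` to `i`, if there is one (in a graph with at most
one edge from `j` to `i`); otherwise it is `0`, and plays no role because `a i j = 0`. -/
noncomputable def edgeWeight (G : WeightedDigraph V E) (i j : V) : ℝ :=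
  if h : ∃ e : E, G.I e = j ∧ G.O e = i then G.W h.choose else 0

/-- The matrix with entries `a i j * exp (- s⁻¹ * w i j)`. -/
noncomputable def decayMatrix (G : WeightedDigraph V E) (s : ℝ) : Matrix V V ℝ :=
  Matrix.of fun i j => G.adjMatrix i j * Real.exp (-s⁻¹ * G.edgeWeight i j)

end WeightedDigraph

/-- The spectral radius of a real square matrix: the largest modulus of its complex eigenvalues. -/
noncomputable def matrixSpectralRadius {V : Type*} [Fintype V] [DecidableEq V]
    (M : Matrix V V ℝ) : ENNReal :=
  spectralRadius ℂ (M.map (fun t : ℝ => (t : ℂ)))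

/-! Put σ = 1/s and let T_σ be the matrix whose (i, j) entry sums exp(-σ W e) over edges e from j to
i. Everything rests on one σ > 0 with a positive vector f fixed by T_σ
(`StronglyConnected.exists_fixed_transferMatrix`); it comes from maximizing σ over pairs (σ, v) with
v ≤ T_σ v, and σ = 0 is excluded because it would force a cycle.

Testing T_τ against f bounds its spectral radius below 1 for τ > σ and above 1 for τ < σ, so σ is
unique (`spectralRadius_transferMatrix_eq_one_iff`).

Deleting the last edge of a path gives a renewal recursion for the number of paths from u to v of
weight at most y. Since exp(σ y) f(v) solves the homogeneous recursion exactly, induction on y traps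
this number between c exp(σ y) f(v), for large y, and C (1 + y/m) exp(σ y) f(v). Logarithms erase
the constants and the linear factor; inverting the count gives p_r / log r → 1/σ
(`tendsto_div_log_of_ncard_bounds`). -/

open Filter Topology

/-! ### Spectral radius bounds from positive test vectors -/

namespace Matrix

variable {V : Type*} [Fintype V] [DecidableEq V]

/-- A nonnegative matrix with a positive `r`-subinvariant vector has spectral radius at most `r`. -/
theorem spectralRadius_le_of_mulVec_le {B : Matrix V V ℝ} (hB : ∀ i j, 0 ≤ B i j) {u : V → ℝ}
    (hu : ∀ i, 0 < u i) {r : ℝ} (hBu : ∀ i, (B *ᵥ u) i ≤ r * u i) :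
    matrixSpectralRadius B ≤ ENNReal.ofReal r := by
  refine iSup₂_le fun z hz => ?_
  rw [← spectrum_toLin', ← Module.End.hasEigenvalue_iff_mem_spectrum] at hz
  obtain ⟨x, hx⟩ := hz.exists_hasEigenvector
  have hxz : B.map (fun t : ℝ => (t : ℂ)) *ᵥ x = z • x := by
    simpa using hx.apply_eq_smul
  obtain ⟨k, hk⟩ : ∃ k, x k ≠ 0 := Function.ne_iff.1 hx.2
  -- Evaluating the eigenvector equation where |x i| / u i is largest controls every other
  -- coordinate by c * u j.
  obtain ⟨i, -, hi⟩ := Finset.exists_max_image Finset.univ (fun i => ‖x i‖ / u i) ⟨k, by simp⟩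
  set c := ‖x i‖ / u i
  have hc (j : V) : ‖x j‖ ≤ c * u j := (div_le_iff₀ (hu j)).1 (hi j (by simp))
  have hc0 : 0 < c := lt_of_lt_of_le (div_pos (norm_pos_iff.2 hk) (hu k)) (hi k (by simp))
  have hci : ‖x i‖ = c * u i := (div_eq_iff (hu i).ne').1 rfl
  have hxi : 0 < ‖x i‖ := hci ▸ mul_pos hc0 (hu i)
  have key : ‖z‖ * ‖x i‖ ≤ r * ‖x i‖ := by
    calc ‖z‖ * ‖x i‖ = ‖(B.map (fun t : ℝ => (t : ℂ)) *ᵥ x) i‖ := by rw [hxz]; simp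
      _ ≤ ∑ j, ‖(B i j : ℂ) * x j‖ := norm_sum_le _ _
      _ ≤ ∑ j, c * (B i j * u j) := by
        refine Finset.sum_le_sum fun j _ => ?_
        rw [norm_mul, Complex.norm_real, Real.norm_of_nonneg (hB i j)]
        calc B i j * ‖x j‖ ≤ B i j * (c * u j) := mul_le_mul_of_nonneg_left (hc j) (hB i j)
          _ = _ := by ring
      _ = c * (B *ᵥ u) i := by rw [← Finset.mul_sum]; rfl
      _ ≤ c * (r * u i) := mul_le_mul_of_nonneg_left (hBu i) hc0.le
      _ = r * ‖x i‖ := by rw [hci]; ring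
  have hzr : ‖z‖ ≤ r := le_of_mul_le_mul_right key hxi
  calc (‖z‖₊ : ENNReal) = ENNReal.ofReal ‖z‖ := (ofReal_norm z).symm
    _ ≤ ENNReal.ofReal r := ENNReal.ofReal_le_ofReal hzr

theorem pow_mul_le_pow_mulVec {B : Matrix V V ℝ} (hB : ∀ i j, 0 ≤ B i j) {u : V → ℝ}
    {r : ℝ} (hr : 0 ≤ r) (hBu : ∀ i, r * u i ≤ (B *ᵥ u) i) (n : ℕ) (i : V) :
    r ^ n * u i ≤ ((B ^ n) *ᵥ u) i := by
  induction n generalizing i with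
  | zero => simp
  | succ n ih =>
    calc r ^ (n + 1) * u i = r ^ n * (r * u i) := by ring
      _ ≤ r ^ n * (B *ᵥ u) i := mul_le_mul_of_nonneg_left (hBu i) (pow_nonneg hr n)
      _ = ∑ j, B i j * (r ^ n * u j) := by
        simp only [mulVec, dotProduct, Finset.mul_sum]
        exact Finset.sum_congr rfl fun j _ => by ring
      _ ≤ ∑ j, B i j * ((B ^ n) *ᵥ u) j :=
        Finset.sum_le_sum fun j _ => mul_le_mul_of_nonneg_left (ih j) (hB i j)
      _ = ((B ^ (n + 1)) *ᵥ u) i := by rw [pow_succ', ← mulVec_mulVec]; rfl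

/-- A nonnegative matrix with a positive `r`-superinvariant vector has spectral radius at
least `r`. -/
theorem le_spectralRadius_of_le_mulVec [Nonempty V] {B : Matrix V V ℝ} (hB : ∀ i j, 0 ≤ B i j)
    {u : V → ℝ} (hu : ∀ i, 0 < u i) {r : ℝ} (hr : 0 ≤ r) (hBu : ∀ i, r * u i ≤ (B *ᵥ u) i) :
    ENNReal.ofReal r ≤ matrixSpectralRadius B := by
  -- Gelfand's formula is applied in the operator norm of the sup norm on vectors, so a single
  -- coordinate of A ^ n w bounds ‖A ^ n‖ from below.
  let _ := Matrix.linftyOpNormedRing (n := V) (α := ℂ)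
  let _ := Matrix.linftyOpNormedAlgebra (n := V) (R := ℂ) (α := ℂ)
  set A : Matrix V V ℂ := B.map (fun t : ℝ => (t : ℂ)) with hA
  have hlim := spectrum.pow_norm_pow_one_div_tendsto_nhds_spectralRadius A
  obtain ⟨k⟩ := ‹Nonempty V›
  set w : V → ℂ := fun i => (u i : ℂ) with hw
  have hAn (n : ℕ) : (A ^ n) *ᵥ w = fun i => (((B ^ n) *ᵥ u) i : ℂ) := by
    have h1 : A = Complex.ofRealHom.mapMatrix B := rfl
    rw [h1, ← map_pow]
    ext i
    simp [mulVec, dotProduct, hw]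
  have hw0 : 0 < ‖w‖ := norm_pos_iff.2 fun h => by
    have := congrFun h k
    simp [hw, (hu k).ne'] at this
  set c := u k / ‖w‖
  have hc : 0 < c := div_pos (hu k) hw0
  have hn (n : ℕ) : c * r ^ n ≤ ‖A ^ n‖ := by
    have h1 := linfty_opNorm_mulVec (A ^ n) w
    have h2 := norm_le_pi_norm ((A ^ n) *ᵥ w) k
    rw [hAn] at h2
    have h3 := pow_mul_le_pow_mulVec hB hr hBu n k
    have h4 : ‖((((B ^ n) *ᵥ u) k : ℝ) : ℂ)‖ = ((B ^ n) *ᵥ u) k := by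
      rw [Complex.norm_real, Real.norm_of_nonneg]
      exact le_trans (mul_nonneg (pow_nonneg hr n) (hu k).le) h3
    rw [h4, ← hAn] at h2
    rw [show c * r ^ n = (r ^ n * u k) / ‖w‖ by simp only [c]; ring, div_le_iff₀ hw0]
    exact (h3.trans h2).trans h1
  have hl : Tendsto (fun n : ℕ => ENNReal.ofReal (c ^ (1 / (n : ℝ)) * r)) atTop
      (𝓝 (ENNReal.ofReal r)) := by
    refine ENNReal.tendsto_ofReal ?_
    have h1 : Tendsto (fun n : ℕ => 1 / (n : ℝ)) atTop (𝓝 0) := tendsto_one_div_atTop_nhds_zero_nat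
    have h2 := (Real.continuousAt_const_rpow (b := 0) hc.ne').tendsto.comp h1
    simpa using h2.mul_const r
  refine le_of_tendsto_of_tendsto hl hlim ?_
  filter_upwards [eventually_gt_atTop 0] with n hn0
  refine ENNReal.ofReal_le_ofReal ?_
  calc c ^ (1 / (n : ℝ)) * r = (c * r ^ n) ^ (1 / (n : ℝ)) := by
        rw [Real.mul_rpow hc.le (pow_nonneg hr n), one_div, Real.pow_rpow_inv_natCast hr hn0.ne']
    _ ≤ _ := Real.rpow_le_rpow (mul_nonneg hc.le (pow_nonneg hr n)) (hn n) (by positivity)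

end Matrix

/-! ### Counting paths of bounded weight -/

namespace WeightedDigraph

variable {V E : Type*} (G : WeightedDigraph V E)

theorem pathWeight_append_singleton (x : List E) (e : E) :
    G.pathWeight (x ++ [e]) = G.pathWeight x + G.W e := by
  simp [pathWeight]

theorem length_mul_le_pathWeight {m : ℝ} (hm : ∀ e, m ≤ G.W e) (x : List E) :
    x.length * m ≤ G.pathWeight x := by
  induction x with
  | nil => simp [pathWeight]
  | cons e x ih =>
    have := hm e
    simp only [pathWeight, List.map_cons, List.sum_cons, List.length_cons] at ih ⊢
    push_cast
    linarith

theorem pathWeight_pos_of_ne_nil {x : List E} (hx : x ≠ []) : 0 < G.pathWeight x :=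
  List.sum_pos _ (by simp [G.W_pos]) (by simpa using hx)

theorem isPath_singleton_iff {u v : V} {e : E} : G.IsPath u v [e] ↔ G.I e = u ∧ G.O e = v := by
  simp [IsPath]

theorem isPath_append_singleton_iff {u v : V} {x : List E} (hx : x ≠ []) {e : E} :
    G.IsPath u v (x ++ [e]) ↔ G.IsPath u (G.I e) x ∧ G.O e = v := by
  simp only [IsPath, List.isChain_append, List.getLast?_eq_some_getLast hx]
  simp [hx]
  tauto

/-- The paths from `u` to `v` of weight at most `y`. -/
def pathsLE (u v : V) (y : ℝ) : Set (List E) :=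
  {x | G.IsPath u v x ∧ G.pathWeight x ≤ y}

theorem exists_pos_le_weight [Finite E] : ∃ m, 0 < m ∧ ∀ e, m ≤ G.W e := by
  cases nonempty_fintype E
  rcases isEmpty_or_nonempty E with h | h
  · exact ⟨1, one_pos, h.elim⟩
  · obtain ⟨e, he⟩ := Finite.exists_min G.W
    exact ⟨G.W e, G.W_pos e, he⟩

theorem exists_weight_le [Finite E] : ∃ b, 0 ≤ b ∧ ∀ e, G.W e ≤ b := by
  rcases isEmpty_or_nonempty E with h | h
  · exact ⟨0, le_rfl, h.elim⟩
  · obtain ⟨e, he⟩ := Finite.exists_max G.W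
    exact ⟨G.W e, (G.W_pos e).le, he⟩

theorem finite_pathWeight_le [Finite E] (y : ℝ) : {x | G.pathWeight x ≤ y}.Finite := by
  obtain ⟨m, hm, hmW⟩ := G.exists_pos_le_weight
  refine (List.finite_length_le E ⌈y / m⌉₊).subset fun x hx => ?_
  have h1 := G.length_mul_le_pathWeight hmW x
  have h2 : (x.length : ℝ) ≤ y / m := (le_div_iff₀ hm).2 (h1.trans hx)
  exact Nat.cast_le.1 (h2.trans (Nat.le_ceil _))

theorem finite_pathsLE [Finite E] (u v : V) (y : ℝ) : (G.pathsLE u v y).Finite :=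
  (G.finite_pathWeight_le y).subset fun _ hx => hx.2

variable [Fintype E] [DecidableEq V]

/-- Appending a last edge is injective, and different last edges give different paths. One-edge
paths are not produced, hence only an inequality. -/
theorem sum_ncard_pathsLE_le (u v : V) (y : ℝ) :
    ∑ e with G.O e = v, (G.pathsLE u (G.I e) (y - G.W e)).ncard ≤ (G.pathsLE u v y).ncard := by
  classical
  have hinj (e : E) : Function.Injective fun x : List E => x ++ [e] :=
    List.append_left_injective [e]
  simp only [Set.ncard_eq_toFinset_card _ (G.finite_pathsLE u _ _)]
  calc _ = ∑ e with G.O e = v,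
        ((G.finite_pathsLE u (G.I e) (y - G.W e)).toFinset.image fun x => x ++ [e]).card :=
        Finset.sum_congr rfl fun e _ => (Finset.card_image_of_injective _ (hinj e)).symm
    _ = _ := (Finset.card_biUnion ?_).symm
    _ ≤ _ := Finset.card_le_card ?_
  · intro e _ e' _ hne
    refine Finset.disjoint_left.2 fun x hx hx' => hne ?_
    obtain ⟨a, -, rfl⟩ := Finset.mem_image.1 hx
    obtain ⟨b, -, hb⟩ := Finset.mem_image.1 hx'
    exact (List.append_inj' hb rfl).2 |> List.singleton_inj.1 |>.symm
  · intro x hx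
    obtain ⟨e, he, hx⟩ := Finset.mem_biUnion.1 hx
    obtain ⟨a, ha, rfl⟩ := Finset.mem_image.1 hx
    have ha' := (Set.Finite.mem_toFinset _).1 ha
    refine (Set.Finite.mem_toFinset _).2 ⟨?_, ?_⟩
    · exact (G.isPath_append_singleton_iff ha'.1.2.1).2 ⟨ha'.1, (Finset.mem_filter.1 he).2⟩
    · rw [pathWeight_append_singleton]
      linarith [ha'.2]

/-- Deleting the last edge reverses the extension; the `+ 1` pays for the one-edge path `[e]`, whose
remainder is empty and so not a path. -/
theorem ncard_pathsLE_le_sum (u v : V) (y : ℝ) :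
    (G.pathsLE u v y).ncard ≤ ∑ e with G.O e = v ∧ G.W e ≤ y,
      ((G.pathsLE u (G.I e) (y - G.W e)).ncard + 1) := by
  classical
  simp only [Set.ncard_eq_toFinset_card _ (G.finite_pathsLE u _ _)]
  calc _ ≤ (Finset.biUnion {e | G.O e = v ∧ G.W e ≤ y} fun e => insert [e]
        ((G.finite_pathsLE u (G.I e) (y - G.W e)).toFinset.image fun x => x ++ [e])).card :=
        Finset.card_le_card ?_
    _ ≤ _ := Finset.card_biUnion_le
    _ ≤ _ := Finset.sum_le_sum fun e _ => (Finset.card_insert_le _ _).trans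
        (Nat.add_le_add_right Finset.card_image_le 1)
  intro x hx
  obtain ⟨hx1, hx2⟩ := (Set.Finite.mem_toFinset _).1 hx
  rcases List.eq_nil_or_concat' x with rfl | ⟨a, e, rfl⟩
  · exact absurd rfl hx1.2.1
  rw [pathWeight_append_singleton] at hx2
  refine Finset.mem_biUnion.2 ⟨e, ?_, ?_⟩
  · have h1 : G.O e = v := by simpa using hx1.2.2.2
    have h2 : 0 ≤ G.pathWeight a := List.sum_nonneg (by simp [(G.W_pos _).le])
    exact Finset.mem_filter.2 ⟨Finset.mem_univ _, h1, by linarith⟩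
  · rcases eq_or_ne a [] with rfl | ha
    · simp
    · refine Finset.mem_insert_of_mem (Finset.mem_image_of_mem _ ?_)
      exact (Set.Finite.mem_toFinset _).2
        ⟨((G.isPath_append_singleton_iff ha).1 hx1).1, by linarith⟩

/-- Exponential lower bound for the number of paths of bounded weight. -/
theorem exists_mul_exp_le_ncard_pathsLE [Finite V] (hG : G.StronglyConnected) {σ : ℝ} (hσ : 0 ≤ σ)
    {f : V → ℝ} (hf : ∀ v, 0 < f v)
    (hfix : ∀ v, ∑ e with G.O e = v, Real.exp (-σ * G.W e) * f (G.I e) = f v) (u : V) :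
    ∃ c x₀ : ℝ, 0 < c ∧ ∀ v y, x₀ ≤ y →
      c * Real.exp (σ * y) * f v ≤ ((G.pathsLE u v y).ncard : ℝ) := by
  obtain ⟨m, hm, hmW⟩ := G.exists_pos_le_weight
  obtain ⟨b, hb, hbW⟩ := G.exists_weight_le
  have : Nonempty V := ⟨u⟩
  choose γ hγ using hG u
  obtain ⟨w, hw⟩ := Finite.exists_max fun v => G.pathWeight (γ v)
  obtain ⟨k, hk⟩ := Finite.exists_max f
  set D := G.pathWeight (γ w)
  -- This makes the bound at most 1 on the window [D, D + b], where `γ v` already supplies a path.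
  -- The window has length b so that y - W e stays above D once y ≥ D + b; each induction step then
  -- extends the range by m.
  set c := (Real.exp (σ * (D + b)) * f k)⁻¹ with hc
  have hc0 : 0 < c := inv_pos.2 (mul_pos (Real.exp_pos _) (hf k))
  have key (n : ℕ) : ∀ v y, D ≤ y → y ≤ D + b + n * m →
      c * Real.exp (σ * y) * f v ≤ ((G.pathsLE u v y).ncard : ℝ) := by
    have base (v : V) (y : ℝ) (hy : D ≤ y) (hy' : y ≤ D + b) :
        c * Real.exp (σ * y) * f v ≤ ((G.pathsLE u v y).ncard : ℝ) := by
      have h1 : (1 : ℝ) ≤ (G.pathsLE u v y).ncard :=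
        Nat.one_le_cast.2 ((Set.ncard_pos (G.finite_pathsLE u v y)).2
          ⟨γ v, hγ v, (hw v).trans hy⟩)
      refine le_trans ?_ h1
      have h2 : Real.exp (σ * y) * f v ≤ Real.exp (σ * (D + b)) * f k :=
        mul_le_mul (Real.exp_le_exp.2 (mul_le_mul_of_nonneg_left hy' hσ)) (hk v) (hf v).le
          (Real.exp_pos _).le
      rw [mul_assoc, hc, inv_mul_le_iff₀ (mul_pos (Real.exp_pos _) (hf k)), mul_one]
      exact h2
    induction n with
    | zero => exact fun v y hy hy' => base v y hy (by simpa using hy')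
    | succ n ih =>
      intro v y hy hy'
      rcases le_total y (D + b) with h | h
      · exact base v y hy h
      calc c * Real.exp (σ * y) * f v
          = ∑ e with G.O e = v, c * Real.exp (σ * (y - G.W e)) * f (G.I e) := by
            rw [← hfix v, Finset.mul_sum]
            refine Finset.sum_congr rfl fun e _ => ?_
            rw [show σ * (y - G.W e) = σ * y + -σ * G.W e by ring, Real.exp_add]
            ring
        _ ≤ ∑ e with G.O e = v, ((G.pathsLE u (G.I e) (y - G.W e)).ncard : ℝ) := by
            refine Finset.sum_le_sum fun e _ => ih _ _ (by linarith [hbW e]) ?_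
            push_cast at hy'
            linarith [hmW e]
        _ ≤ _ := by exact_mod_cast G.sum_ncard_pathsLE_le u v y
  refine ⟨c, D, hc0, fun v y hy => ?_⟩
  obtain ⟨n, hn⟩ := exists_nat_ge (y / m)
  refine key n v y hy ?_
  have h1 : y ≤ n * m := (div_le_iff₀ hm).1 hn
  have h2 : 0 < D := G.pathWeight_pos_of_ne_nil (hγ w).2.1
  linarith

/-- Exponential upper bound, up to a linear factor, for the number of paths of bounded weight. -/
theorem exists_ncard_pathsLE_le_mul_exp [Finite V] {σ : ℝ} (hσ : 0 ≤ σ)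
    {f : V → ℝ} (hf : ∀ v, 0 < f v)
    (hfix : ∀ v, ∑ e with G.O e = v, Real.exp (-σ * G.W e) * f (G.I e) = f v) (u : V) :
    ∃ C m : ℝ, 0 < C ∧ 0 < m ∧ ∀ v y, 0 ≤ y →
      ((G.pathsLE u v y).ncard : ℝ) ≤ C * (1 + y / m) * Real.exp (σ * y) * f v := by
  obtain ⟨m, hm, hmW⟩ := G.exists_pos_le_weight
  have : Nonempty V := ⟨u⟩
  obtain ⟨k, hk⟩ := Finite.exists_min f
  -- The extra 1 keeps C positive even without edges.
  set C : ℝ := (Fintype.card E + 1) / f k with hC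
  have hC0 : 0 < C := div_pos (by positivity) (hf k)
  have hCf (v : V) : (Fintype.card E : ℝ) ≤ C * f v := by
    have h1 : C * f k = Fintype.card E + 1 := div_mul_cancel₀ _ (hf k).ne'
    have h2 := mul_le_mul_of_nonneg_left (hk v) hC0.le
    linarith
  have key (n : ℕ) : ∀ v y, 0 ≤ y → y < n * m →
      ((G.pathsLE u v y).ncard : ℝ) ≤ C * (1 + y / m) * Real.exp (σ * y) * f v := by
    induction n with
    | zero => intro v y hy hy'; simp at hy'; linarith
    | succ n ih =>
      intro v y hy hy'
      push_cast at hy'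
      have hterm (e : E) (he : G.W e ≤ y) : ((G.pathsLE u (G.I e) (y - G.W e)).ncard : ℝ) ≤
          C * (y / m) * Real.exp (σ * y) * (Real.exp (-σ * G.W e) * f (G.I e)) := by
        refine (ih (G.I e) (y - G.W e) (by linarith) (by linarith [hmW e])).trans ?_
        rw [show σ * (y - G.W e) = σ * y + -σ * G.W e by ring, Real.exp_add]
        -- As W e ≥ m, the linear factor drops by one unit, which leaves room for the `+ 1` terms.
        have h1 : 1 + (y - G.W e) / m ≤ y / m := by
          rw [sub_div]
          linarith [(one_le_div hm).2 (hmW e)]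
        calc _ = (1 + (y - G.W e) / m) *
              (C * (Real.exp (σ * y) * Real.exp (-σ * G.W e)) * f (G.I e)) := by ring
          _ ≤ y / m * (C * (Real.exp (σ * y) * Real.exp (-σ * G.W e)) * f (G.I e)) :=
            mul_le_mul_of_nonneg_right h1 (by have := hf (G.I e); positivity)
          _ = _ := by ring
      calc ((G.pathsLE u v y).ncard : ℝ) ≤ ∑ e with G.O e = v ∧ G.W e ≤ y,
            (((G.pathsLE u (G.I e) (y - G.W e)).ncard : ℝ) + 1) := by
            exact_mod_cast G.ncard_pathsLE_le_sum u v y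
        _ ≤ ∑ e with G.O e = v ∧ G.W e ≤ y,
            (C * (y / m) * Real.exp (σ * y) * (Real.exp (-σ * G.W e) * f (G.I e)) + 1) :=
            Finset.sum_le_sum fun e he =>
              add_le_add_left (hterm e (Finset.mem_filter.1 he).2.2) 1
        _ ≤ ∑ e with G.O e = v,
            (C * (y / m) * Real.exp (σ * y) * (Real.exp (-σ * G.W e) * f (G.I e)) + 1) := by
            refine Finset.sum_le_sum_of_subset_of_nonneg (fun e he => ?_) fun e _ _ => ?_
            · simp only [Finset.mem_filter] at he ⊢
              exact ⟨he.1, he.2.1⟩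
            · have := hf (G.I e)
              positivity
        _ ≤ C * (y / m) * Real.exp (σ * y) * f v + Fintype.card E := by
            rw [Finset.sum_add_distrib, ← Finset.mul_sum, hfix]
            refine add_le_add_right ?_ _
            rw [Finset.sum_const, nsmul_eq_mul, mul_one]
            exact_mod_cast Finset.card_le_univ _
        _ ≤ C * (y / m) * Real.exp (σ * y) * f v + C * f v * Real.exp (σ * y) := by
            refine add_le_add_right ((hCf v).trans ?_) _
            exact le_mul_of_one_le_right (mul_pos hC0 (hf v)).le
              (Real.one_le_exp (mul_nonneg hσ hy))
        _ = _ := by ring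
  refine ⟨C, m, hC0, hm, fun v y hy => ?_⟩
  obtain ⟨n, hn⟩ := exists_nat_gt (y / m)
  exact key n v y hy ((div_lt_iff₀ hm).1 hn)

end WeightedDigraph

/-! ### Ascending enumerations and inversion of the counting function -/

/-- An infinite type with a real function whose sublevel sets are finite can be enumerated in
ascending order. -/
theorem exists_equiv_pnat_monotone {X : Type*} [Countable X] [Infinite X] (f : X → ℝ)
    (hf : ∀ y, {x | f x ≤ y}.Finite) : ∃ e : ℕ+ ≃ X, Monotone fun r => f (e r) := by
  obtain ⟨g, hg⟩ := exists_injective_nat X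
  -- Ties in f are broken by an injection into ℕ, so each element has finitely many predecessors and
  -- is determined by their number.
  set F : X → ℝ ×ₗ ℕ := fun x => toLex (f x, g x) with hF
  have hFinj : Function.Injective F := fun x y h => hg (congrArg (fun z => (ofLex z).2) h)
  have hlef {x y : X} (h : F x ≤ F y) : f x ≤ f y := by
    rcases Prod.Lex.le_iff.1 h with h | h
    · exact h.le
    · exact h.1.le
  have hfin (x : X) : {y | F y < F x}.Finite := (hf (f x)).subset fun y hy => hlef (le_of_lt hy)
  set rk : X → ℕ := fun x => {y | F y < F x}.ncard
  have hlt {x y : X} (h : F x < F y) : rk x < rk y :=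
    Set.ncard_lt_ncard ⟨fun z hz => lt_trans hz h, fun hs => lt_irrefl (F x) (hs h)⟩ (hfin y)
  have hinj : Function.Injective rk := fun x y h => by
    rcases lt_trichotomy (F x) (F y) with h' | h' | h'
    · exact absurd h (hlt h').ne
    · exact hFinj h'
    · exact absurd h (hlt h').ne'
  have : Infinite (Set.range rk) := Set.infinite_coe_iff.2 (Set.infinite_range_of_injective hinj)
  let o := Nat.Subtype.orderIsoOfNat (Set.range rk)
  let e := Equiv.ofInjective rk hinj
  refine ⟨Equiv.pnatEquivNat.trans (o.toEquiv.trans e.symm), fun r s hrs => ?_⟩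
  refine hlef (not_lt.1 fun h => ?_)
  have h1 := hlt h
  have h2 (n : ℕ) : rk (e.symm (o n)) = o n := Equiv.apply_ofInjective_symm hinj (o n)
  have h3 : o (Equiv.pnatEquivNat r) ≤ o (Equiv.pnatEquivNat s) :=
    o.monotone (Nat.sub_le_sub_right hrs 1)
  have h4 : (o (Equiv.pnatEquivNat s) : ℕ) < o (Equiv.pnatEquivNat r) := by
    simpa only [Equiv.trans_apply, RelIso.coe_fn_toEquiv, h2] using h1
  exact absurd h3 (not_le.2 h4)

theorem le_ncard_sublevel {X : Type*} {f : X → ℝ} (hf : ∀ y, {x | f x ≤ y}.Finite) {e : ℕ+ ≃ X}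
    (he : Monotone fun r => f (e r)) (r : ℕ+) : (r : ℕ) ≤ {x | f x ≤ f (e r)}.ncard := by
  have h : (Finset.Icc 1 r).card = r := by simp
  rw [← Set.ncard_coe_finset, ← Set.ncard_image_of_injective _ e.injective] at h
  rw [← h]
  refine Set.ncard_le_ncard ?_ (hf _)
  rintro _ ⟨k, hk, rfl⟩
  exact he (Finset.mem_Icc.1 hk).2

theorem ncard_sublevel_le {X : Type*} {f : X → ℝ} {e : ℕ+ ≃ X}
    (he : Monotone fun r => f (e r)) (r : ℕ+) {y : ℝ} (hy : y < f (e r)) :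
    {x | f x ≤ y}.ncard ≤ (r : ℕ) := by
  have h : (Finset.Icc 1 r).card = r := by simp
  rw [← Set.ncard_coe_finset, ← Set.ncard_image_of_injective _ e.injective] at h
  rw [← h]
  refine Set.ncard_le_ncard (fun x hx => ?_) (((Finset.Icc 1 r).finite_toSet).image _)
  refine ⟨e.symm x, ?_, by simp⟩
  refine Finset.mem_coe.2 (Finset.mem_Icc.2 ⟨one_le, le_of_lt (not_le.1 fun h => ?_)⟩)
  have h1 : f (e r) ≤ f x := by simpa using he h
  exact absurd (h1.trans hx) (not_le.2 hy)

/-- At y = p_r the counting function is at least r, and at p_r - 1 it is at most r, whatever the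
multiplicities. Taking logarithms squeezes log r / p_r to σ. -/
theorem tendsto_div_log_of_ncard_bounds {X : Type*} {f : X → ℝ}
    (hf : ∀ y, {x | f x ≤ y}.Finite) {e : ℕ+ ≃ X} (he : Monotone fun r => f (e r))
    {σ c C m x₀ : ℝ} (hσ : 0 < σ) (hc : 0 < c) (hC : 0 < C) (hm : 0 < m)
    (hlow : ∀ y, x₀ ≤ y → c * Real.exp (σ * y) ≤ {x | f x ≤ y}.ncard)
    (hup : ∀ y, 0 ≤ y → ({x | f x ≤ y}.ncard : ℝ) ≤ C * (1 + y / m) * Real.exp (σ * y)) :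
    Tendsto (fun r : ℕ+ => f (e r) / Real.log (r : ℝ)) atTop (𝓝 σ⁻¹) := by
  have hp : Tendsto (fun r : ℕ+ => f (e r)) atTop atTop := by
    refine tendsto_atTop.2 fun Y => ?_
    filter_upwards [eventually_gt_atTop (Nat.succPNat {x | f x ≤ Y}.ncard)] with r hr
    by_contra! h
    have h1 := le_ncard_sublevel hf he r
    have h2 : {x | f x ≤ f (e r)}.ncard ≤ {x | f x ≤ Y}.ncard :=
      Set.ncard_le_ncard (fun x hx => le_trans hx h.le) (hf Y)
    have h3 : {x | f x ≤ Y}.ncard + 1 < (r : ℕ) := hr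
    omega
  have hinv (a : ℝ) : Tendsto (fun y : ℝ => a / y) atTop (𝓝 0) :=
    tendsto_const_nhds.div_atTop tendsto_id
  have hlog : Tendsto (fun y : ℝ => Real.log (1 + y / m) / y) atTop (𝓝 0) := by
    have h1 : Tendsto (fun y : ℝ => 1 + y / m) atTop atTop :=
      tendsto_atTop_add_const_left _ _ (tendsto_id.atTop_div_const hm)
    have h2 := (Real.isLittleO_log_id_atTop.tendsto_div_nhds_zero.comp h1).mul
      ((hinv 1).add_const (1 / m))
    simp only [zero_mul] at h2
    refine h2.congr' ?_
    filter_upwards [eventually_gt_atTop 0] with y hy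
    have : 1 + y / m ≠ 0 := by positivity
    simp only [Function.comp_apply, id]
    field_simp
  have hlim₁ : Tendsto (fun y : ℝ => (Real.log c + σ * (y - 1)) / y) atTop (𝓝 σ) := by
    have h := (hinv (Real.log c - σ)).const_add σ
    rw [add_zero] at h
    refine h.congr' ?_
    filter_upwards [eventually_gt_atTop 0] with y hy
    field_simp
    ring
  have hlim₂ : Tendsto (fun y : ℝ => (Real.log C + Real.log (1 + y / m) + σ * y) / y) atTop
      (𝓝 σ) := by
    have h := ((hinv (Real.log C)).add hlog).add_const σ
    rw [add_zero, zero_add] at h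
    refine h.congr' ?_
    filter_upwards [eventually_gt_atTop 0] with y hy
    field_simp
  have hlim : Tendsto (fun r : ℕ+ => Real.log (r : ℝ) / f (e r)) atTop (𝓝 σ) := by
    refine tendsto_of_tendsto_of_tendsto_of_le_of_le' (hlim₁.comp hp) (hlim₂.comp hp) ?_ ?_
    · filter_upwards [hp.eventually_gt_atTop 0, hp.eventually_ge_atTop (x₀ + 1)] with r hr0 hr1
      refine div_le_div_of_nonneg_right ?_ hr0.le
      have h1 := hlow (f (e r) - 1) (by linarith)
      have h2 : ({x | f x ≤ f (e r) - 1}.ncard : ℝ) ≤ (r : ℕ) :=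
        Nat.cast_le.2 (ncard_sublevel_le he r (by linarith))
      have h3 := Real.log_le_log (by positivity) (h1.trans h2)
      rwa [Real.log_mul hc.ne' (Real.exp_ne_zero _), Real.log_exp] at h3
    · filter_upwards [hp.eventually_gt_atTop 0] with r hr0
      refine div_le_div_of_nonneg_right ?_ hr0.le
      have h1 : ((r : ℕ) : ℝ) ≤ ({x | f x ≤ f (e r)}.ncard : ℝ) :=
        Nat.cast_le.2 (le_ncard_sublevel hf he r)
      have h2 := Real.log_le_log (Nat.cast_pos.2 r.pos) (h1.trans (hup _ hr0.le))
      have h3 : 1 + f (e r) / m ≠ 0 := by positivity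
      rwa [Real.log_mul (mul_ne_zero hC.ne' h3) (Real.exp_ne_zero _), Real.log_mul hC.ne' h3,
        Real.log_exp] at h2
  simpa only [inv_div] using hlim.inv₀ hσ.ne'

/-! ### Positivity from irreducibility -/

namespace Matrix

variable {V : Type*} [Fintype V]

theorem mulVec_pos {P : Matrix V V ℝ} (hP : ∀ i j, 0 < P i j) {v : V → ℝ} (hv : ∀ i, 0 ≤ v i)
    (hv0 : v ≠ 0) (i : V) : 0 < (P *ᵥ v) i := by
  obtain ⟨k, hk⟩ := Function.ne_iff.1 hv0
  exact Finset.sum_pos' (fun j _ => mul_nonneg (hP i j).le (hv j))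
    ⟨k, Finset.mem_univ k, mul_pos (hP i k) (lt_of_le_of_ne (hv k) (Ne.symm hk))⟩

variable [DecidableEq V]

theorem pow_nonneg_entry {T : Matrix V V ℝ} (hT : ∀ i j, 0 ≤ T i j) (n : ℕ) (i j : V) :
    0 ≤ (T ^ n) i j := by
  induction n generalizing i j with
  | zero => rw [pow_zero, one_apply]; split_ifs <;> simp
  | succ n ih =>
    rw [pow_succ, mul_apply]
    exact Finset.sum_nonneg fun k _ => mul_nonneg (ih i k) (hT k j)

/-- For an irreducible nonnegative matrix some polynomial in it has only positive entries. -/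
theorem exists_pos_commute {T : Matrix V V ℝ} (hT : ∀ i j, 0 ≤ T i j)
    (hirr : ∀ i j, ∃ k, 0 < (T ^ k) i j) :
    ∃ P : Matrix V V ℝ, (∀ i j, 0 < P i j) ∧ Commute P T ∧
      ∃ c : ℝ, ∀ v, T *ᵥ v = v → P *ᵥ v = c • v := by
  choose k hk using hirr
  refine ⟨∑ p : V × V, T ^ k p.1 p.2, fun i j => ?_, ?_, Fintype.card (V × V), fun v hv => ?_⟩
  · rw [sum_apply]
    exact Finset.sum_pos' (fun p _ => pow_nonneg_entry hT _ i j) ⟨(i, j), by simp, hk i j⟩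
  · exact Commute.sum_left _ _ _ fun p _ => (Commute.refl T).pow_left _
  · have hn (n : ℕ) : (T ^ n) *ᵥ v = v := by
      induction n with
      | zero => simp
      | succ n ih => rw [pow_succ, ← mulVec_mulVec, hv, ih]
    rw [sum_mulVec]
    simp only [hn, Finset.sum_const, Finset.card_univ]
    ext i
    simp

end Matrix

/-! ### The transfer matrix and its Perron vector -/

namespace WeightedDigraph

variable {V E : Type*} {G : WeightedDigraph V E}

theorem le_of_isPath {f : V → ℝ} (hf : ∀ e, f (G.I e) ≤ f (G.O e)) {u v : V} {x : List E}
    (hx : G.IsPath u v x) : f u ≤ f v := by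
  induction x using List.reverseRecOn generalizing v with
  | nil => exact absurd rfl hx.2.1
  | append_singleton x e ih =>
    rcases eq_or_ne x [] with rfl | hx0
    · obtain ⟨rfl, rfl⟩ := G.isPath_singleton_iff.1 hx
      exact hf e
    · obtain ⟨h1, rfl⟩ := (G.isPath_append_singleton_iff hx0).1 hx
      exact (ih h1).trans (hf e)

theorem StronglyConnected.exists_outgoing (hG : G.StronglyConnected) (v : V) : ∃ e, G.I e = v := by
  obtain ⟨x, -, h, h1, -⟩ := hG v v
  exact ⟨_, h1⟩

theorem StronglyConnected.exists_incoming (hG : G.StronglyConnected) (v : V) : ∃ e, G.O e = v := by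
  obtain ⟨x, -, h, -, h1⟩ := hG v v
  exact ⟨_, h1⟩

variable [DecidableEq V] [Fintype E] (G)

/-- The entry at `(i, j)` is the sum of `exp (- σ * W e)` over the edges `e` from `j` to `i`. -/
noncomputable def transferMatrix (σ : ℝ) : Matrix V V ℝ :=
  Matrix.of fun i j => ∑ e with G.O e = i ∧ G.I e = j, Real.exp (-σ * G.W e)

theorem decayMatrix_eq_transferMatrix (hG : G.AtMostOneEdge) (s : ℝ) :
    G.decayMatrix s = G.transferMatrix s⁻¹ := by
  ext i j
  simp only [decayMatrix, adjMatrix, edgeWeight, transferMatrix, Matrix.of_apply]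
  by_cases h : ∃ e, G.I e = j ∧ G.O e = i
  · have hs := h.choose_spec
    have hfil : Finset.univ.filter (fun e => G.O e = i ∧ G.I e = j) = {h.choose} := by
      ext e
      simp only [Finset.mem_filter, Finset.mem_univ, true_and, Finset.mem_singleton]
      refine ⟨fun he => hG _ _ (he.2.trans hs.1.symm) (he.1.trans hs.2.symm), ?_⟩
      rintro rfl
      exact ⟨hs.2, hs.1⟩
    rw [hfil, Finset.sum_singleton, if_pos h, dif_pos h, one_mul]
  · rw [if_neg h, zero_mul, Finset.sum_eq_zero]
    exact fun e he => absurd ⟨e, (Finset.mem_filter.1 he).2.symm⟩ h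

theorem transferMatrix_nonneg (σ : ℝ) (i j : V) : 0 ≤ G.transferMatrix σ i j :=
  Finset.sum_nonneg fun _ _ => (Real.exp_pos _).le

theorem transferMatrix_edge_pos (σ : ℝ) (e : E) : 0 < G.transferMatrix σ (G.O e) (G.I e) :=
  Finset.sum_pos (fun _ _ => Real.exp_pos _) ⟨e, by simp⟩

variable [Fintype V]

theorem transferMatrix_mulVec (σ : ℝ) (f : V → ℝ) (i : V) :
    (G.transferMatrix σ).mulVec f i =
      ∑ e with G.O e = i, Real.exp (-σ * G.W e) * f (G.I e) := by
  simp only [Matrix.mulVec, dotProduct, transferMatrix, Matrix.of_apply, Finset.sum_mul]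
  rw [← Finset.sum_fiberwise _ G.I]
  refine Finset.sum_congr rfl fun j _ => ?_
  rw [Finset.filter_filter]
  refine Finset.sum_congr rfl fun e he => ?_
  rw [(Finset.mem_filter.1 he).2.2]

theorem transferMatrix_pow_pos (σ : ℝ) {u v : V} {x : List E} (hx : G.IsPath u v x) :
    0 < (G.transferMatrix σ ^ x.length) v u := by
  induction x using List.reverseRecOn generalizing v with
  | nil => exact absurd rfl hx.2.1
  | append_singleton x e ih =>
    rcases eq_or_ne x [] with rfl | hx0
    · obtain ⟨rfl, rfl⟩ := G.isPath_singleton_iff.1 hx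
      simpa using G.transferMatrix_edge_pos σ e
    · obtain ⟨h1, rfl⟩ := (G.isPath_append_singleton_iff hx0).1 hx
      rw [List.length_append, List.length_singleton, pow_succ', Matrix.mul_apply]
      exact Finset.sum_pos'
        (fun k _ => mul_nonneg (G.transferMatrix_nonneg σ _ k)
          (Matrix.pow_nonneg_entry (G.transferMatrix_nonneg σ) _ k u))
        ⟨G.I e, Finset.mem_univ _, mul_pos (G.transferMatrix_edge_pos σ e) (ih h1)⟩

variable {G}

/-- Each f (I e) is one of the positive terms summing to f (O e), so f grows along edges and strong
connectivity makes it constant. All in-degrees are then 1, so |E| = |V|, and surjectivity of `I`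
gives out-degrees 1. -/
theorem isCycle_of_fixed (hG : G.StronglyConnected) {f : V → ℝ} (hf : ∀ v, 0 < f v)
    (hfix : ∀ v, ∑ e with G.O e = v, f (G.I e) = f v) : G.IsCycle := by
  have hle (e : E) : f (G.I e) ≤ f (G.O e) := by
    rw [← hfix (G.O e)]
    exact Finset.single_le_sum (f := fun e => f (G.I e)) (fun e _ => (hf (G.I e)).le) (by simp)
  have hconst (u v : V) : f u = f v := by
    obtain ⟨x, hx⟩ := hG u v
    obtain ⟨y, hy⟩ := hG v u
    exact le_antisymm (le_of_isPath hle hx) (le_of_isPath hle hy)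
  have hin (v : V) : (Finset.univ.filter fun e => G.O e = v).card = 1 := by
    have h := hfix v
    rw [Finset.sum_congr rfl fun e _ => hconst (G.I e) v, Finset.sum_const, nsmul_eq_mul] at h
    exact_mod_cast mul_right_cancel₀ (hf v).ne' (h.trans (one_mul _).symm)
  have hO : Function.Bijective G.O := by
    refine ⟨fun e e' h => ?_, hG.exists_incoming⟩
    exact Finset.card_le_one.1 (hin (G.O e')).le e (by simp [h]) e' (by simp)
  have hI : Function.Bijective G.I :=
    (Fintype.bijective_iff_surjective_and_card _).2
      ⟨hG.exists_outgoing, Fintype.card_of_bijective hO⟩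
  have hone {g : E → V} (hg : Function.Bijective g) (v : V) : {e | g e = v}.ncard = 1 := by
    obtain ⟨e, he⟩ := hg.2 v
    refine Set.ncard_eq_one.2 ⟨e, Set.ext fun e' => ⟨fun h => hg.1 (h.trans he.symm), ?_⟩⟩
    rintro rfl
    exact he
  exact ⟨hG, fun v => ⟨hone hO v, hone hI v⟩⟩

theorem StronglyConnected.exists_fixed_transferMatrix [Nonempty V] (hG : G.StronglyConnected)
    (hcycle : ¬ G.IsCycle) :
    ∃ σ : ℝ, 0 < σ ∧ ∃ f : V → ℝ, (∀ v, 0 < f v) ∧ (G.transferMatrix σ).mulVec f = f := by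
  obtain ⟨m, hm, hmW⟩ := G.exists_pos_le_weight
  have hcont (i : V) : Continuous fun p : ℝ × (V → ℝ) => (G.transferMatrix p.1).mulVec p.2 i := by
    simp only [transferMatrix_mulVec]
    fun_prop
  -- Summing v ≤ T_σ v over the vertices gives 1 ≤ |E| exp(-σ m). Hence feasible σ are bounded and a
  -- maximum exists.
  have hbound {σ : ℝ} {v : V → ℝ} (hσ : 0 ≤ σ) (hv : v ∈ stdSimplex ℝ V)
      (h : ∀ i, v i ≤ (G.transferMatrix σ).mulVec v i) : σ ≤ Fintype.card E / m := by
    have h1 : (1 : ℝ) ≤ Fintype.card E * Real.exp (-(σ * m)) := by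
      calc (1 : ℝ) = ∑ i, v i := hv.2.symm
        _ ≤ ∑ i, ∑ e with G.O e = i, Real.exp (-σ * G.W e) * v (G.I e) :=
          Finset.sum_le_sum fun i _ => (h i).trans_eq (G.transferMatrix_mulVec σ v i)
        _ = ∑ e, Real.exp (-σ * G.W e) * v (G.I e) := Finset.sum_fiberwise _ _ _
        _ ≤ ∑ e : E, Real.exp (-(σ * m)) := by
          refine Finset.sum_le_sum fun e _ => ?_
          have h2 : v (G.I e) ≤ 1 := hv.2 ▸
            Finset.single_le_sum (fun i _ => hv.1 i) (Finset.mem_univ _)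
          refine (mul_le_of_le_one_right (Real.exp_pos _).le h2).trans (Real.exp_le_exp.2 ?_)
          have := mul_le_mul_of_nonneg_left (hmW e) hσ
          linarith
        _ = _ := by simp
    have h2 : Real.exp (σ * m) ≤ Fintype.card E := by
      rwa [Real.exp_neg, ← div_eq_mul_inv, one_le_div (Real.exp_pos _)] at h1
    rw [le_div_iff₀ hm]
    linarith [Real.add_one_le_exp (σ * m)]
  set K : Set (ℝ × (V → ℝ)) := (Set.Icc 0 (Fintype.card E / m) ×ˢ stdSimplex ℝ V) ∩
    {p | ∀ i, p.2 i ≤ (G.transferMatrix p.1).mulVec p.2 i} with hK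
  have hKc : IsCompact K := by
    refine (isCompact_Icc.prod (isCompact_stdSimplex ℝ V)).inter_right ?_
    simp only [Set.ofPred_forall]
    exact isClosed_iInter fun i => isClosed_le (by fun_prop) (hcont i)
  have hKne : K.Nonempty := by
    have hcard : (Fintype.card V : ℝ) ≠ 0 := by simp
    have hv : (fun _ => (Fintype.card V : ℝ)⁻¹) ∈ stdSimplex ℝ V :=
      ⟨fun _ => by positivity, by simp⟩
    have h : ∀ i : V, (Fintype.card V : ℝ)⁻¹ ≤
        (G.transferMatrix 0).mulVec (fun _ => (Fintype.card V : ℝ)⁻¹) i := by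
      intro i
      rw [transferMatrix_mulVec]
      obtain ⟨e, he⟩ := hG.exists_incoming i
      have := Finset.single_le_sum (s := Finset.univ.filter fun e => G.O e = i)
        (f := fun e => Real.exp (-0 * G.W e) * (Fintype.card V : ℝ)⁻¹)
        (fun e _ => by positivity) (a := e) (by simp [he])
      simpa using this
    exact ⟨(0, _), ⟨⟨⟨le_rfl, by positivity⟩, hv⟩, h⟩⟩
  obtain ⟨⟨σ, v⟩, ⟨⟨⟨hσ0, hσb⟩, hv⟩, hle⟩, hmax⟩ :=
    hKc.exists_isMaxOn hKne continuous_fst.continuousOn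
  have hv0 : v ≠ 0 := by
    rintro rfl
    simpa using hv.2
  obtain ⟨P, hP, hPT, c, hPc⟩ := Matrix.exists_pos_commute (G.transferMatrix_nonneg σ)
    fun i j => let ⟨x, hx⟩ := hG j i; ⟨x.length, G.transferMatrix_pow_pos σ hx⟩
  have hPv := Matrix.mulVec_pos hP hv.1 hv0
  -- Were v ≤ T_σ v not an equality, the positive matrix P, commuting with T_σ, would turn it into
  -- strict inequality in all coordinates for P v. That survives a small increase of σ, against
  -- maximality.
  have hfix : (G.transferMatrix σ).mulVec v = v := by
    by_contra hne
    have hstrict (i : V) : P.mulVec v i < (G.transferMatrix σ).mulVec (P.mulVec v) i := by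
      have h1 := Matrix.mulVec_pos hP (v := (G.transferMatrix σ).mulVec v - v)
        (fun i => sub_nonneg.2 (hle i)) (sub_ne_zero.2 hne) i
      rw [Matrix.mulVec_sub, Matrix.mulVec_mulVec, hPT.eq, ← Matrix.mulVec_mulVec] at h1
      exact sub_pos.1 h1
    have hev : ∀ᶠ σ' in 𝓝[>] σ, ∀ i, P.mulVec v i < (G.transferMatrix σ').mulVec (P.mulVec v) i :=
      eventually_all.2 fun i => nhdsWithin_le_nhds <|
        ((hcont i).comp (Continuous.prodMk_left (P.mulVec v))).continuousAt.eventually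
          (lt_mem_nhds (hstrict i))
    obtain ⟨σ', hσ', hlt⟩ := (hev.and self_mem_nhdsWithin).exists
    have hS : 0 < ∑ i, P.mulVec v i := Finset.sum_pos (fun i _ => hPv i) Finset.univ_nonempty
    set y : V → ℝ := (∑ i, P.mulVec v i)⁻¹ • P.mulVec v with hy
    have hymem : y ∈ stdSimplex ℝ V := by
      refine ⟨fun i => mul_nonneg (inv_pos.2 hS).le (hPv i).le, ?_⟩
      simp only [hy, Pi.smul_apply, smul_eq_mul, ← Finset.mul_sum]
      exact inv_mul_cancel₀ hS.ne'
    have hyle (i : V) : y i ≤ (G.transferMatrix σ').mulVec y i := by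
      rw [hy, Matrix.mulVec_smul]
      exact mul_le_mul_of_nonneg_left (hσ' i).le (inv_pos.2 hS).le
    have hσ'0 : 0 ≤ σ' := hσ0.trans (le_of_lt hlt)
    have h1 : σ' ≤ σ := hmax (a := (σ', y)) ⟨⟨⟨hσ'0, hbound hσ'0 hymem hyle⟩, hymem⟩, hyle⟩
    exact absurd h1 (not_le.2 hlt)
  have hpos (i : V) : 0 < v i := by
    refine lt_of_le_of_ne (hv.1 i) fun h => ?_
    have h1 := hPv i
    rw [hPc v hfix, Pi.smul_apply, ← h, smul_zero] at h1
    exact lt_irrefl _ h1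
  refine ⟨σ, lt_of_le_of_ne hσ0 ?_, v, hpos, hfix⟩
  rintro rfl
  refine hcycle (isCycle_of_fixed hG hpos fun i => ?_)
  simpa [transferMatrix_mulVec] using congrFun hfix i

theorem spectralRadius_transferMatrix_le {σ τ m : ℝ} (hm : ∀ e, m ≤ G.W e) (hστ : σ ≤ τ)
    {f : V → ℝ} (hf : ∀ v, 0 < f v) (hfix : (G.transferMatrix σ).mulVec f = f) :
    matrixSpectralRadius (G.transferMatrix τ) ≤ ENNReal.ofReal (Real.exp ((σ - τ) * m)) := by
  refine Matrix.spectralRadius_le_of_mulVec_le (G.transferMatrix_nonneg τ) hf fun i => ?_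
  conv_rhs => rw [← hfix]
  rw [transferMatrix_mulVec, transferMatrix_mulVec, Finset.mul_sum]
  refine Finset.sum_le_sum fun e _ => ?_
  rw [← mul_assoc, ← Real.exp_add]
  refine mul_le_mul_of_nonneg_right (Real.exp_le_exp.2 ?_) (hf _).le
  nlinarith [mul_nonneg (sub_nonneg.2 hστ) (sub_nonneg.2 (hm e))]

theorem le_spectralRadius_transferMatrix [Nonempty V] {σ τ m : ℝ} (hm : ∀ e, m ≤ G.W e)
    (hστ : τ ≤ σ) {f : V → ℝ} (hf : ∀ v, 0 < f v) (hfix : (G.transferMatrix σ).mulVec f = f) :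
    ENNReal.ofReal (Real.exp ((σ - τ) * m)) ≤ matrixSpectralRadius (G.transferMatrix τ) := by
  refine Matrix.le_spectralRadius_of_le_mulVec (G.transferMatrix_nonneg τ) hf
    (Real.exp_pos _).le fun i => ?_
  conv_lhs => rw [← hfix]
  rw [transferMatrix_mulVec, transferMatrix_mulVec, Finset.mul_sum]
  refine Finset.sum_le_sum fun e _ => ?_
  rw [← mul_assoc, ← Real.exp_add]
  refine mul_le_mul_of_nonneg_right (Real.exp_le_exp.2 ?_) (hf _).le
  nlinarith [mul_nonneg (sub_nonneg.2 hστ) (sub_nonneg.2 (hm e))]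

/-- Since every weight is at least m > 0, passing from σ to τ moves the spectral radius past exp((σ
- τ) m), strictly away from 1 unless τ = σ. -/
theorem spectralRadius_transferMatrix_eq_one_iff [Nonempty V] {σ τ : ℝ} {f : V → ℝ}
    (hf : ∀ v, 0 < f v) (hfix : (G.transferMatrix σ).mulVec f = f) :
    matrixSpectralRadius (G.transferMatrix τ) = 1 ↔ τ = σ := by
  obtain ⟨m, hm, hmW⟩ := G.exists_pos_le_weight
  constructor
  · intro h
    rcases lt_trichotomy τ σ with h1 | h1 | h1
    · have h2 := le_spectralRadius_transferMatrix hmW h1.le hf hfix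
      rw [h, ENNReal.ofReal_le_one, Real.exp_le_one_iff] at h2
      exact absurd h2 (not_le.2 (mul_pos (sub_pos.2 h1) hm))
    · exact h1
    · have h2 := spectralRadius_transferMatrix_le hmW h1.le hf hfix
      rw [h, ENNReal.one_le_ofReal, Real.one_le_exp_iff] at h2
      exact absurd h2 (not_le.2 (mul_neg_of_neg_of_pos (sub_neg.2 h1) hm))
  · rintro rfl
    refine le_antisymm ?_ ?_
    · simpa using spectralRadius_transferMatrix_le hmW le_rfl hf hfix
    · simpa using le_spectralRadius_transferMatrix hmW le_rfl hf hfix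

end WeightedDigraph

/-! ### Assembling the theorem -/

namespace WeightedDigraph

variable {V E : Type*} (G : WeightedDigraph V E)

theorem ncard_paths_weight_le (u v : V) (y : ℝ) :
    {x : G.paths u v | G.pathWeight x ≤ y}.ncard = (G.pathsLE u v y).ncard := by
  rw [← Set.ncard_image_of_injective _ Subtype.val_injective]
  congr 1
  ext x
  constructor
  · rintro ⟨x, hx, rfl⟩
    exact ⟨x.2, hx⟩
  · exact fun hx => ⟨⟨x, hx.1⟩, hx.2, rfl⟩

end WeightedDigraph

theorem mainTheorem2 {V E : Type*} [Fintype V] [DecidableEq V] [Fintype E]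
    (G : WeightedDigraph V E) (hG : G.AtMostOneEdge)
    (hconn : G.StronglyConnected) (hcycle : ¬ G.IsCycle) :
    ∃ s : ℝ, 0 < s ∧ matrixSpectralRadius (G.decayMatrix s) = 1 ∧
      (∀ t : ℝ, 0 < t → matrixSpectralRadius (G.decayMatrix t) = 1 → t = s) ∧
      ∀ v₁ v₂ : V,
        (∃ p : ℕ+ → ℝ, G.IsSequenceOfWeights (G.paths v₁ v₂) p) ∧
        ∀ p : ℕ+ → ℝ, G.IsSequenceOfWeights (G.paths v₁ v₂) p →
          Filter.Tendsto (fun r : ℕ+ => p r / Real.log (r : ℝ)) Filter.atTop (nhds s) := by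
  -- The empty graph is vacuously a cycle.
  have hV : Nonempty V := by
    by_contra h
    exact hcycle ⟨hconn, fun v => (h ⟨v⟩).elim⟩
  obtain ⟨σ, hσ, f, hf, hfix⟩ := hconn.exists_fixed_transferMatrix hcycle
  have hfix' (v : V) : ∑ e with G.O e = v, Real.exp (-σ * G.W e) * f (G.I e) = f v :=
    (G.transferMatrix_mulVec σ f v).symm.trans (congrFun hfix v)
  have hiff (t : ℝ) : matrixSpectralRadius (G.decayMatrix t) = 1 ↔ t⁻¹ = σ := by
    rw [G.decayMatrix_eq_transferMatrix hG,
      WeightedDigraph.spectralRadius_transferMatrix_eq_one_iff hf hfix]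
  refine ⟨σ⁻¹, inv_pos.2 hσ, (hiff _).2 (inv_inv σ),
    fun t _ ht => inv_eq_iff_eq_inv.1 ((hiff t).1 ht), fun u v => ?_⟩
  have hfin (y : ℝ) : {x : G.paths u v | G.pathWeight x ≤ y}.Finite :=
    (G.finite_pathWeight_le y).preimage Subtype.val_injective.injOn
  obtain ⟨c, x₀, hc, hlow⟩ := G.exists_mul_exp_le_ncard_pathsLE hconn hσ.le hf hfix' u
  obtain ⟨C, m, hC, hm, hup⟩ := G.exists_ncard_pathsLE_le_mul_exp hσ.le hf hfix' u
  refine ⟨?_, ?_⟩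
  -- The exponential lower bound is unbounded in y, so it also rules out finitely many paths.
  · have : Infinite (G.paths u v) := by
      by_contra hinf
      have : Finite (G.paths u v) := not_infinite_iff_finite.1 hinf
      have hle (y : ℝ) (hy : x₀ ≤ y) :
          c * Real.exp (σ * y) * f v ≤ (Nat.card (G.paths u v) : ℝ) := by
        refine (hlow v y hy).trans (Nat.cast_le.2 ?_)
        rw [← G.ncard_paths_weight_le, ← Set.ncard_univ]
        exact Set.ncard_le_ncard (Set.subset_univ _)
      have hlim : Filter.Tendsto (fun y => c * Real.exp (σ * y) * f v) Filter.atTop Filter.atTop :=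
        ((Real.tendsto_exp_atTop.comp (Filter.tendsto_id.const_mul_atTop hσ)).const_mul_atTop
          hc).atTop_mul_const (hf v)
      obtain ⟨y, hy, hy'⟩ := ((hlim.eventually_gt_atTop (Nat.card (G.paths u v) : ℝ)).and
        (Filter.eventually_ge_atTop x₀)).exists
      exact absurd (hle y hy') (not_le.2 hy)
    have : Countable (List E) := inferInstance
    obtain ⟨e, he⟩ := exists_equiv_pnat_monotone (fun x : G.paths u v => G.pathWeight x) hfin
    exact ⟨_, he, e, fun _ => rfl⟩
  · rintro p ⟨hp, e, hpe⟩
    obtain rfl : p = fun r => G.pathWeight (e r : List E) := funext hpe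
    refine tendsto_div_log_of_ncard_bounds (f := fun x : G.paths u v => G.pathWeight x) hfin hp
      (c := c * f v) (C := C * f v) (m := m) (x₀ := x₀) hσ (mul_pos hc (hf v))
      (mul_pos hC (hf v)) hm (fun y hy => ?_) fun y hy => ?_
    · rw [G.ncard_paths_weight_le]
      exact (hlow v y hy).trans_eq' (by ring)
    · rw [G.ncard_paths_weight_le]
      exact (hup v y hy).trans_eq (by ring)
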